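/- Let $\mathbb{T}=\{\xi=z_1+i_2z_2 : z_1,z_2\in\mathbb{C}\}$ be the bicomplex numbers, where $\mathbb{C}=\mathbb{R}+i_1\mathbb{R}$, $i_1^2=i_2^2=-1$, $i_1i_2=i_2i_1$, with norm $\|\xi\|=\sqrt{|z_1|^2+|z_2|^2}$. Put $e_1=\frac{1+i_1i_2}{2}$, $e_2=\frac{1-i_1i_2}{2}$, and write $\xi=\xi_1e_1+\xi_2e_2$ with $\xi_1=z_1-i_1z_2$, $\xi_2=z_1+i_1z_2\in\mathbb{C}$. The bicomplex Gamma function, exponential and (principal) power are $\Gamma(\xi)=\Gamma(\xi_1)e_1+\Gamma(\xi_2)e_2$, $e^{\xi}=e^{\xi_1}e_1+e^{\xi_2}e_2$ and $\omega^{\beta}=\omega_1^{\beta_1}e_1+\omega_2^{\beta_2}e_2$, and the bicomplex Mittag-Leffler function is $\mathbb{E}_\alpha(\xi)=\sum_{k=0}^\infty \frac{\xi^k}{\Gamma(\alpha k+1)}$. **Theorem.** Let $\alpha>0$ be real and $\xi\in\mathbb{T}$. For $i=1,2$ let $\Omega_i:\mathbb{R}\to\mathbb{C}$ be a piecewise continuously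 differentiable loop starting and ending at $-\infty$ and encircling the disk $|\omega_i|\le|\xi_i|^{1/\alpha}$ in the positive sense, with $|\arg\omega_i|<\pi$ on $\Omega_i$; that is, $|\Omega_i(t)|>|\xi_i|^{1/\alpha}$ and $|\arg\Omega_i(t)|<\pi$ for all $t$, $|\Omega_i(t)|\to\infty$ as $t\to\pm\infty$, and $\arg\Omega_i(t)\to\pm\pi$ as $t\to\pm\infty$. Let $H=(\Omega_1,\Omega_2)$ be the curve $H(t)=\Omega_1(t)e_1+\Omega_2(t)e_2$ in $\mathbb{T}$ (so that $|\arg_j\omega|_j=|\arg\omega_1|e_1+|\arg\omega_2|e_2<\pi$ componentwise on $H$). Then the series for $\mathbb{E}_\alpha(\xi)$ converges, $\omega^\alpha-\xi$ is invertible at every point $\omega$ of $H$, the improper integral below, understood as $\lim_{a\to-\infty,\,b\to\infty}\int_a^b f(H(t))H'(t)\,dt$ with $f$ the integrand, converges, and $$\mathbb{E}_\alpha(\xi)=\frac{1}{2\pi i_1}\int_H\frac{\omega^{\alpha-1}e^{\omega}}{\omega^{\alpha}-\xi}\,d\omega .$$ -/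

import Mathlib

open Filter Topology MeasureTheory

noncomputable section

/-- Bicomplex numbers `z₁ + i₂ z₂` with `z₁ z₂ : ℂ`; the imaginary unit `i₁` is `Complex.I`. -/
@[ext]
structure Bicomplex where
  z₁ : ℂ
  z₂ : ℂ

namespace Bicomplex

instance : Zero Bicomplex := ⟨⟨0, 0⟩⟩
instance : One Bicomplex := ⟨⟨1, 0⟩⟩
instance : Add Bicomplex := ⟨fun x y => ⟨x.z₁ + y.z₁, x.z₂ + y.z₂⟩⟩
instance : Neg Bicomplex := ⟨fun x => ⟨-x.z₁, -x.z₂⟩⟩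
instance : Sub Bicomplex := ⟨fun x y => ⟨x.z₁ - y.z₁, x.z₂ - y.z₂⟩⟩

/-- Multiplication determined by `i₂ ^ 2 = -1`. -/
instance : Mul Bicomplex :=
  ⟨fun x y => ⟨x.z₁ * y.z₁ - x.z₂ * y.z₂, x.z₁ * y.z₂ + x.z₂ * y.z₁⟩⟩

instance : SMul ℝ Bicomplex := ⟨fun r x => ⟨r • x.z₁, r • x.z₂⟩⟩

@[simp] theorem zero_z₁ : (0 : Bicomplex).z₁ = 0 := rfl
@[simp] theorem zero_z₂ : (0 : Bicomplex).z₂ = 0 := rfl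
@[simp] theorem one_z₁ : (1 : Bicomplex).z₁ = 1 := rfl
@[simp] theorem one_z₂ : (1 : Bicomplex).z₂ = 0 := rfl
@[simp] theorem add_z₁ (x y : Bicomplex) : (x + y).z₁ = x.z₁ + y.z₁ := rfl
@[simp] theorem add_z₂ (x y : Bicomplex) : (x + y).z₂ = x.z₂ + y.z₂ := rfl
@[simp] theorem neg_z₁ (x : Bicomplex) : (-x).z₁ = -x.z₁ := rfl
@[simp] theorem neg_z₂ (x : Bicomplex) : (-x).z₂ = -x.z₂ := rfl
@[simp] theorem sub_z₁ (x y : Bicomplex) : (x - y).z₁ = x.z₁ - y.z₁ := rfl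
@[simp] theorem sub_z₂ (x y : Bicomplex) : (x - y).z₂ = x.z₂ - y.z₂ := rfl
@[simp] theorem mul_z₁ (x y : Bicomplex) : (x * y).z₁ = x.z₁ * y.z₁ - x.z₂ * y.z₂ := rfl
@[simp] theorem mul_z₂ (x y : Bicomplex) : (x * y).z₂ = x.z₁ * y.z₂ + x.z₂ * y.z₁ := rfl
@[simp] theorem smul_z₁ (r : ℝ) (x : Bicomplex) : (r • x).z₁ = r • x.z₁ := rfl
@[simp] theorem smul_z₂ (r : ℝ) (x : Bicomplex) : (r • x).z₂ = r • x.z₂ := rfl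

instance : CommRing Bicomplex where
  add_assoc x y z := by ext1 <;> simp [add_assoc]
  zero_add x := by ext1 <;> simp
  add_zero x := by ext1 <;> simp
  add_comm x y := by ext1 <;> simp [add_comm]
  neg_add_cancel x := by ext1 <;> simp
  sub_eq_add_neg x y := by ext1 <;> simp [sub_eq_add_neg]
  mul_assoc x y z := by ext1 <;> simp <;> ring
  one_mul x := by ext1 <;> simp
  mul_one x := by ext1 <;> simp
  zero_mul x := by ext1 <;> simp
  mul_zero x := by ext1 <;> simp
  left_distrib x y z := by ext1 <;> simp <;> ring
  right_distrib x y z := by ext1 <;> simp <;> ring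
  mul_comm x y := by ext1 <;> simp <;> ring
  nsmul := nsmulRec
  zsmul := zsmulRec

instance : Module ℝ Bicomplex where
  one_smul x := by ext1 <;> simp
  mul_smul r s x := by ext1 <;> simp [mul_assoc]
  smul_zero r := by ext1 <;> simp
  smul_add r x y := by ext1 <;> simp
  add_smul r s x := by ext1 <;> simp [add_mul]
  zero_smul x := by ext1 <;> simp

/-- The pair of complex coordinates, as a point of the Euclidean space `ℂ²`. -/
def toEuclidean : Bicomplex →ₗ[ℝ] WithLp 2 (ℂ × ℂ) where
  toFun x := WithLp.toLp 2 (x.z₁, x.z₂)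
  map_add' _ _ := rfl
  map_smul' _ _ := rfl

theorem toEuclidean_injective : Function.Injective toEuclidean := by
  intro x y h
  have h' : (x.z₁, x.z₂) = (y.z₁, y.z₂) := congrArg WithLp.ofLp h
  exact Bicomplex.ext (congrArg Prod.fst h') (congrArg Prod.snd h')

/-- The Euclidean norm on bicomplex numbers, see `Bicomplex.norm_eq`. -/
instance : NormedAddCommGroup Bicomplex :=
  NormedAddCommGroup.induced Bicomplex (WithLp 2 (ℂ × ℂ)) toEuclidean toEuclidean_injective

instance : NormedSpace ℝ Bicomplex :=
  NormedSpace.induced ℝ Bicomplex (WithLp 2 (ℂ × ℂ)) toEuclidean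

theorem norm_eq (x : Bicomplex) : ‖x‖ = Real.sqrt (‖x.z₁‖ ^ 2 + ‖x.z₂‖ ^ 2) :=
  WithLp.prod_norm_eq_of_L2 (toEuclidean x)

/-- The inclusion of `ℂ = ℝ + i₁ ℝ` into the bicomplex numbers. -/
def ofComplex (z : ℂ) : Bicomplex := ⟨z, 0⟩

instance : Coe ℂ Bicomplex := ⟨ofComplex⟩

/-- The second imaginary unit. -/
def i₂ : Bicomplex := ⟨0, 1⟩

/-- The idempotent `e₁ = (1 + i₁ i₂) / 2`. -/
def e₁ : Bicomplex := ((1 / 2 : ℂ) : Bicomplex) * (1 + (Complex.I : Bicomplex) * i₂)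

/-- The idempotent `e₂ = (1 - i₁ i₂) / 2`. -/
def e₂ : Bicomplex := ((1 / 2 : ℂ) : Bicomplex) * (1 - (Complex.I : Bicomplex) * i₂)

/-- The first idempotent component `ξ₁ = z₁ - i₁ z₂`. -/
def P₁ (ξ : Bicomplex) : ℂ := ξ.z₁ - Complex.I * ξ.z₂

/-- The second idempotent component `ξ₂ = z₁ + i₁ z₂`. -/
def P₂ (ξ : Bicomplex) : ℂ := ξ.z₁ + Complex.I * ξ.z₂

/-- The bicomplex number `a e₁ + b e₂` with idempotent components `a` and `b`. -/
def ofIdem (a b : ℂ) : Bicomplex := (a : Bicomplex) * e₁ + (b : Bicomplex) * e₂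

theorem ofIdem_P (ξ : Bicomplex) : ofIdem (P₁ ξ) (P₂ ξ) = ξ := by
  ext1 <;> simp [ofIdem, P₁, P₂, e₁, e₂, i₂, ofComplex] <;> ring_nf <;> simp

theorem P₁_ofIdem (a b : ℂ) : P₁ (ofIdem a b) = a := by
  simp [ofIdem, P₁, e₁, e₂, i₂, ofComplex]; ring_nf; simp; ring

theorem P₂_ofIdem (a b : ℂ) : P₂ (ofIdem a b) = b := by
  simp [ofIdem, P₂, e₁, e₂, i₂, ofComplex]; ring_nf; simp; ring

/-- The bicomplex exponential. -/
def exp (ξ : Bicomplex) : Bicomplex := ofIdem (Complex.exp (P₁ ξ)) (Complex.exp (P₂ ξ))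

/-- The principal power `ω ^ a` of bicomplex numbers. -/
def cpow (ω a : Bicomplex) : Bicomplex := ofIdem (P₁ ω ^ P₁ a) (P₂ ω ^ P₂ a)

/-- The bicomplex Gamma function `Γ(ξ) = Γ(ξ₁) e₁ + Γ(ξ₂) e₂`. -/
def Gamma (ξ : Bicomplex) : Bicomplex := ofIdem (Complex.Gamma (P₁ ξ)) (Complex.Gamma (P₂ ξ))

/-- The term `ξ ^ k / Γ(α k + 1)`. -/
def mittagLefflerTerm (α ξ : Bicomplex) (k : ℕ) : Bicomplex :=
  ξ ^ k * Ring.inverse (Gamma (α * (k : Bicomplex) + 1))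

/-- The bicomplex one-parameter Mittag-Leffler function `∑ ξ ^ k / Γ(α k + 1)`. -/
def mittagLeffler (α ξ : Bicomplex) : Bicomplex := ∑' k : ℕ, mittagLefflerTerm α ξ k

/-- The integrand `ω ^ (α - 1) e ^ ω / (ω ^ α - ξ)`. -/
def hankelIntegrand (α ξ ω : Bicomplex) : Bicomplex :=
  cpow ω (α - 1) * exp ω * Ring.inverse (cpow ω α - ξ)

/-- The bicomplex curve `H = (Ω₁, Ω₂)`, that is, `t ↦ Ω₁(t) e₁ + Ω₂(t) e₂`. -/
def pairCurve (Ω₁ Ω₂ : ℝ → ℂ) (t : ℝ) : Bicomplex := ofIdem (Ω₁ t) (Ω₂ t)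

/-- The truncated integral `∫ f(ω) dω` over the part of the curve `γ` with parameter between
`a` and `b`. -/
def truncIntegral (f : Bicomplex → Bicomplex) (γ : ℝ → Bicomplex) (a b : ℝ) : Bicomplex :=
  ∫ t in a..b, f (γ t) * deriv γ t

/-- The improper integral of `f` along the infinite curve `γ` converges: `f(γ) γ'` is integrable
on bounded parameter intervals, and the truncated integrals converge as both ends of the
parameter interval go to infinity independently. -/
def CurveIntegrable (f : Bicomplex → Bicomplex) (γ : ℝ → Bicomplex) : Prop :=
  (∀ a b : ℝ, IntervalIntegrable (fun t => f (γ t) * deriv γ t) volume a b) ∧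
    ∃ L : Bicomplex,
      Tendsto (fun p : ℝ × ℝ => truncIntegral f γ p.1 p.2) (atBot ×ˢ atTop) (𝓝 L)

/-- The (improper) integral of `f` along the infinite curve `γ`. -/
def curveIntegral (f : Bicomplex → Bicomplex) (γ : ℝ → Bicomplex) : Bicomplex :=
  limUnder (atBot ×ˢ atTop) (fun p : ℝ × ℝ => truncIntegral f γ p.1 p.2)

end Bicomplex

/-- Piecewise continuously differentiable curves in `ℂ` with parameter in `ℝ`: continuous, and
`C¹` with one-sided limits of the derivative, except at finitely many corners in each bounded
parameter interval. -/
def IsPiecewiseC1 (γ : ℝ → ℂ) : Prop :=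
  Continuous γ ∧ ∃ S : Set ℝ, (∀ a b : ℝ, (S ∩ Set.Icc a b).Finite) ∧
    (∀ t, t ∉ S → ContDiffAt ℝ 1 γ t) ∧
    ∀ t ∈ S, (∃ l, Tendsto (deriv γ) (𝓝[<] t) (𝓝 l)) ∧ ∃ l, Tendsto (deriv γ) (𝓝[>] t) (𝓝 l)

/-- `γ` is a loop starting and ending at `-∞` and encircling the closed disk of radius `r` about
`0` in the positive sense, with `|arg| < π` on it: the curve stays outside the disk and off the
cut, comes from infinity below the cut (where the argument tends to `-π`) and goes to infinity
above the cut (where the argument tends to `π`). -/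
structure IsHankelLoop (r : ℝ) (γ : ℝ → ℂ) : Prop where
  piecewiseC1 : IsPiecewiseC1 γ
  outside : ∀ t, r < ‖γ t‖
  abs_arg_lt : ∀ t, |Complex.arg (γ t)| < Real.pi
  norm_atBot : Tendsto (fun t => ‖γ t‖) atBot atTop
  norm_atTop : Tendsto (fun t => ‖γ t‖) atTop atTop
  arg_atBot : Tendsto (fun t => Complex.arg (γ t)) atBot (𝓝 (-Real.pi))
  arg_atTop : Tendsto (fun t => Complex.arg (γ t)) atTop (𝓝 Real.pi)

end

noncomputable section

/-! All bicomplex operations in the formula act separately on the two idempotent components, so the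
theorem splits into two copies of a scalar Hankel formula, which `Bicomplex.ofIdemL` recombines.

For the scalar formula, put `u = log ω`, which is continuous along the loop because `|arg ω| < π`.
The integrand becomes `hankelDensity` on a half-plane `Re u > const` (all of `ℂ` when `ξ = 0`). This
domain is convex, so the density has a primitive `G` there. No contour deformation is needed: a
truncated integral is a difference of values of `G`, and by `exists_tendsto_primitive_hankelDensity`
the limits of `G` as `Re u → ∞`, `Im u → ±π` do not depend on the path. Hence the improper integral
is the limit of `stripJump G ρ` as `ρ → ∞`.

Expanding the density as a geometric series in `ξ e^(-αu)` turns this jump into a sum of `ξ^k` times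
jumps of primitives of `hankelKernel (α * k)`. Each of these tends to `2πi / Γ(αk + 1)` by
`tendsto_stripJump_hankel`, and the bound `norm_stripJump_primitive_le`, geometric in `k` and
uniform in `ρ`, lets limit and sum be exchanged. -/

/-! ### The Hankel kernel and jumps of its primitives -/

/-- The function `z ^ (-s - 1) e ^ z dz / du` in the logarithmic coordinate `u = log z`. -/
def hankelKernel (s : ℝ) (u : ℂ) : ℂ := Complex.exp (Complex.exp u - s * u)

theorem norm_hankelKernel (s : ℝ) (u : ℂ) :
    ‖hankelKernel s u‖ = Real.exp (Real.exp u.re * Real.cos u.im - s * u.re) := by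
  simp [hankelKernel, Complex.norm_exp, Complex.exp_re]

theorem norm_hankelKernel_le (s : ℝ) (u : ℂ) :
    ‖hankelKernel s u‖ ≤ Real.exp (Real.exp u.re - s * u.re) := by
  rw [norm_hankelKernel]
  gcongr
  exact mul_le_of_le_one_right (Real.exp_pos _).le (Real.cos_le_one _)

theorem hasDerivAt_hankelKernel (s : ℝ) (u : ℂ) :
    HasDerivAt (hankelKernel s) (hankelKernel s u * (Complex.exp u - s)) u := by
  have h := ((Complex.hasDerivAt_exp u).sub ((hasDerivAt_id u).const_mul (s : ℂ))).cexp
  rw [mul_one] at h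
  exact h

theorem continuous_hankelKernel (s : ℝ) : Continuous (hankelKernel s) := by
  unfold hankelKernel; fun_prop

theorem hankelKernel_eq_exp_mul (s : ℝ) (u : ℂ) :
    hankelKernel s u = Complex.exp u * hankelKernel (s + 1) u := by
  rw [hankelKernel, hankelKernel, ← Complex.exp_add]
  push_cast
  ring_nf

theorem exists_primitive_hankelKernel (s : ℝ) :
    ∃ H : ℂ → ℂ, ∀ u, HasDerivAt H (hankelKernel s u) u := by
  obtain ⟨H, hH⟩ := Differentiable.isExactOn_univ
    (f := hankelKernel s) fun u => (hasDerivAt_hankelKernel s u).differentiableAt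
  exact ⟨H, fun u => hH u (Set.mem_univ u)⟩

/-- The increment of `H` across the horizontal strip `|Im u| ≤ π` at `Re u = ρ`. -/
def stripJump (H : ℂ → ℂ) (ρ : ℝ) : ℂ := H (ρ + Real.pi * Complex.I) - H (ρ - Real.pi * Complex.I)

theorem hasDerivAt_horizontal {H h : ℂ → ℂ} {c : ℂ} {ρ : ℝ} (hH : HasDerivAt H (h (ρ + c)) (ρ + c)) :
    HasDerivAt (fun x : ℝ => H (x + c)) (h (ρ + c)) ρ := by
  have h1 : HasDerivAt (fun x : ℂ => H (x + c)) (h (ρ + c)) (ρ : ℂ) := hH.comp_add_const _ _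
  exact h1.comp_ofReal

theorem hasDerivAt_stripJump {H h : ℂ → ℂ} {ρ : ℝ}
    (h₁ : HasDerivAt H (h (ρ + Real.pi * Complex.I)) (ρ + Real.pi * Complex.I))
    (h₂ : HasDerivAt H (h (ρ - Real.pi * Complex.I)) (ρ - Real.pi * Complex.I)) :
    HasDerivAt (stripJump H) (stripJump h ρ) ρ := by
  simp only [sub_eq_add_neg (ρ : ℂ)] at h₂
  unfold stripJump
  simp only [sub_eq_add_neg (ρ : ℂ)]
  exact (hasDerivAt_horizontal h₁).sub (hasDerivAt_horizontal h₂)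

/-- Mean value inequality along a vertical segment. -/
theorem norm_vertical_sub_le {H h : ℂ → ℂ} {ρ a b C : ℝ}
    (hH : ∀ θ ∈ Set.uIcc a b, HasDerivAt H (h (ρ + θ * Complex.I)) (ρ + θ * Complex.I))
    (hC : ∀ θ ∈ Set.uIcc a b, ‖h (ρ + θ * Complex.I)‖ ≤ C) :
    ‖H (ρ + b * Complex.I) - H (ρ + a * Complex.I)‖ ≤ C * |b - a| := by
  have hd : ∀ θ ∈ Set.uIcc a b, HasDerivWithinAt (fun x : ℝ => H (ρ + x * Complex.I))
      (h (ρ + θ * Complex.I) * Complex.I) (Set.uIcc a b) θ := by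
    intro θ hθ
    have h1 : HasDerivAt (fun x : ℂ => (ρ : ℂ) + x * Complex.I) Complex.I (θ : ℂ) := by
      simpa using ((hasDerivAt_id (θ : ℂ)).mul_const Complex.I).const_add (ρ : ℂ)
    exact ((hH θ hθ).comp (θ : ℂ) h1).comp_ofReal.hasDerivWithinAt
  have := (convex_uIcc a b).norm_image_sub_le_of_norm_hasDerivWithin_le (C := C) hd
    (fun θ hθ => by simpa using hC θ hθ) Set.left_mem_uIcc Set.right_mem_uIcc
  simpa using this

theorem norm_stripJump_le {H h : ℂ → ℂ} {ρ C : ℝ}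
    (hH : ∀ u : ℂ, u.re = ρ → HasDerivAt H (h u) u) (hC : ∀ u : ℂ, u.re = ρ → ‖h u‖ ≤ C) :
    ‖stripJump H ρ‖ ≤ C * (2 * Real.pi) := by
  have := norm_vertical_sub_le (H := H) (h := h) (ρ := ρ) (a := -Real.pi) (b := Real.pi) (C := C)
    (fun θ _ => hH _ (by simp)) (fun θ _ => hC _ (by simp))
  rw [sub_neg_eq_add, ← two_mul, abs_of_pos Real.two_pi_pos] at this
  simpa [stripJump, sub_eq_add_neg] using this

theorem norm_hankelKernel_of_cos_eq_neg_one {s ρ c : ℝ} (hc : Real.cos c = -1) :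
    ‖hankelKernel s (ρ + c * Complex.I)‖ = Real.exp (-Real.exp ρ - s * ρ) := by
  simp [norm_hankelKernel, hc]

/-- On both edges of the strip `cos (Im u) = -1`, so the kernel decays doubly exponentially; only
`exp (-ρ)` is kept. The factor `exp (-s * ρ)` stays separate because with `s = α * k` it becomes a
`k`-th power. -/
theorem norm_stripJump_hankelKernel_le {s : ℝ} {ρ : ℝ} :
    ‖stripJump (hankelKernel s) ρ‖ ≤ 2 * (Real.exp (-s * ρ) * Real.exp (-ρ)) := by
  have h1 := norm_hankelKernel_of_cos_eq_neg_one (s := s) (ρ := ρ) Real.cos_pi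
  have h2 := norm_hankelKernel_of_cos_eq_neg_one (s := s) (ρ := ρ) (c := -Real.pi) (by simp)
  have h3 : Real.exp (-Real.exp ρ - s * ρ) ≤ Real.exp (-s * ρ) * Real.exp (-ρ) := by
    rw [← Real.exp_add]
    gcongr
    linarith [Real.add_one_le_exp ρ]
  rw [Complex.ofReal_neg, neg_mul, ← sub_eq_add_neg] at h2
  refine (norm_sub_le _ _).trans ?_
  rw [h1, h2]
  linarith

/-- The jump at `ρ₀` is bounded along the vertical segment of length `2π`, and its growth beyond
`ρ₀` by integrating the edge estimate. The result is uniform in `ρ`, and geometric in `k` when `s =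
α * k`. -/
theorem norm_stripJump_primitive_le {s : ℝ} (hs : 0 ≤ s) {H : ℂ → ℂ}
    (hH : ∀ u, HasDerivAt H (hankelKernel s u) u) {ρ₀ ρ : ℝ} (hρ : ρ₀ ≤ ρ) :
    ‖stripJump H ρ‖ ≤
      Real.exp (-s * ρ₀) * (2 * Real.pi * Real.exp (Real.exp ρ₀) + 2 * Real.exp (-ρ₀)) := by
  set A := Real.exp (-s * ρ₀)
  set M := 2 * Real.pi * Real.exp (Real.exp ρ₀)
  have hJ : ∀ x, HasDerivAt (stripJump H) (stripJump (hankelKernel s) x) x :=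
    fun x => hasDerivAt_stripJump (hH _) (hH _)
  have h0 : ‖stripJump H ρ₀‖ ≤ A * M := by
    refine (norm_stripJump_le (fun u _ => hH u) (C := Real.exp (Real.exp ρ₀ - s * ρ₀)) ?_).trans ?_
    · rintro u rfl
      exact norm_hankelKernel_le s u
    · rw [sub_eq_add_neg, Real.exp_add, ← neg_mul]
      exact le_of_eq (by simp only [A, M]; ring)
  have key := image_norm_le_of_norm_deriv_right_le_deriv_boundary (a := ρ₀) (b := ρ)
    (f := stripJump H) (f' := stripJump (hankelKernel s))
    (B := fun x => A * (M + 2 * Real.exp (-ρ₀) - 2 * Real.exp (-x)))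
    (B' := fun x => A * (2 * Real.exp (-x)))
    (fun x _ => (hJ x).continuousAt.continuousWithinAt) (fun x _ => (hJ x).hasDerivWithinAt)
    (by simpa using h0)
    (fun x => by
      have h1 : HasDerivAt (fun x : ℝ => Real.exp (-x)) (-Real.exp (-x)) x := by
        simpa using (hasDerivAt_neg x).exp
      simpa using ((h1.const_mul 2).const_sub (M + 2 * Real.exp (-ρ₀))).const_mul A)
    (fun x hx => by
      refine norm_stripJump_hankelKernel_le.trans ?_
      have : Real.exp (-s * x) ≤ A := by
        apply Real.exp_le_exp.2
        nlinarith [hx.1]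
      nlinarith [Real.exp_pos (-x)])
    (Set.right_mem_Icc.2 hρ)
  refine key.trans ?_
  have : 0 < Real.exp (-ρ) := Real.exp_pos _
  have : 0 < A := Real.exp_pos _
  gcongr
  linarith

/-! ### Hankel's formula for the reciprocal Gamma function -/

theorem tendsto_hankelKernel_zero {s c : ℝ} (hs : 0 ≤ s) (hc : Real.cos c = -1) :
    Tendsto (fun ρ : ℝ => hankelKernel s (ρ + c * Complex.I)) atTop (𝓝 0) := by
  rw [tendsto_zero_iff_norm_tendsto_zero]
  refine squeeze_zero' (.of_forall fun _ => norm_nonneg _) ?_ Real.tendsto_exp_neg_atTop_nhds_zero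
  filter_upwards [eventually_ge_atTop 0] with ρ hρ
  rw [norm_hankelKernel_of_cos_eq_neg_one hc]
  gcongr
  nlinarith [Real.add_one_le_exp ρ, mul_nonneg hs hρ]

/-- Both edges have `e^u = -e^ρ`, so only the phases `e^(∓iπs)` of `e^(-su)` differ, and their
difference is `-2i sin (πs)`. The real factor is Euler's integrand for `Γ(-s)` after substituting
`e^ρ`. -/
theorem stripJump_hankelKernel (s ρ : ℝ) :
    stripJump (hankelKernel s) ρ =
      (Real.exp ρ * (Real.exp (-Real.exp ρ) * Real.exp ρ ^ (-s - 1)) : ℝ) *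
        (-(2 * Complex.I) * Real.sin (Real.pi * s)) := by
  have h1 : ∀ c : ℂ, Complex.exp c = -1 → hankelKernel s (ρ + c) =
      (Real.exp ρ * (Real.exp (-Real.exp ρ) * Real.exp ρ ^ (-s - 1)) : ℝ) *
        Complex.exp (-(s * c)) := by
    intro c hc
    rw [← Real.exp_mul, ← Real.exp_add, ← Real.exp_add, Complex.ofReal_exp, ← Complex.exp_add,
      hankelKernel, Complex.exp_add, hc]
    push_cast
    ring_nf
  rw [stripJump, h1 _ Complex.exp_pi_mul_I, sub_eq_add_neg (ρ : ℂ), h1 _ (by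
    rw [Complex.exp_neg, Complex.exp_pi_mul_I]; norm_num), ← mul_sub]
  congr 1
  rw [Complex.ofReal_sin, Complex.sin]
  push_cast
  have : Complex.I * Complex.I = -1 := Complex.I_mul_I
  linear_combination (norm := ring_nf)
    (Complex.exp (-(Real.pi * s * Complex.I)) - Complex.exp (Real.pi * s * Complex.I)) * this

theorem integral_exp_substitution_Gamma {s : ℝ} (hs : 0 < s) :
    Integrable (fun x : ℝ => Real.exp x * (Real.exp (-Real.exp x) * Real.exp x ^ (s - 1))) ∧
    ∫ x : ℝ, Real.exp x * (Real.exp (-Real.exp x) * Real.exp x ^ (s - 1)) = Real.Gamma s := by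
  have him : Real.exp '' Set.univ = Set.Ioi 0 := by rw [Set.image_univ, Real.range_exp]
  have hd : ∀ x ∈ (Set.univ : Set ℝ), HasDerivWithinAt Real.exp (Real.exp x) Set.univ x :=
    fun x _ => (Real.hasDerivAt_exp x).hasDerivWithinAt
  have h1 := integral_image_eq_integral_abs_deriv_smul MeasurableSet.univ hd
    Real.exp_injective.injOn (fun x => Real.exp (-x) * x ^ (s - 1))
  have h2 := integrableOn_image_iff_integrableOn_abs_deriv_smul MeasurableSet.univ hd
    Real.exp_injective.injOn (fun x => Real.exp (-x) * x ^ (s - 1))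
  simp only [him, abs_of_pos (Real.exp_pos _), smul_eq_mul, Measure.restrict_univ,
    integrableOn_univ] at h1 h2
  exact ⟨h2.1 (Real.GammaIntegral_convergent hs), by rw [← h1, Real.Gamma_eq_integral hs]⟩

/-- For `s < 0` the jump vanishes as `ρ → -∞`, so its limit at `+∞` is the integral of its
derivative, namely `-2i sin (πs) Γ(-s)`. Euler's reflection formula rewrites this as a reciprocal
Gamma value. -/
theorem tendsto_stripJump_of_neg {s : ℝ} (hs₁ : -1 < s) (hs₀ : s < 0) {H : ℂ → ℂ}
    (hH : ∀ u, HasDerivAt H (hankelKernel s u) u) :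
    Tendsto (stripJump H) atTop (𝓝 (2 * Real.pi * Complex.I / Real.Gamma (s + 1))) := by
  have hJ : ∀ x, HasDerivAt (stripJump H) (stripJump (hankelKernel s) x) x :=
    fun x => hasDerivAt_stripJump (hH _) (hH _)
  obtain ⟨hi, hG⟩ := integral_exp_substitution_Gamma (neg_pos.2 hs₀)
  have hint : Integrable (stripJump (hankelKernel s)) := by
    refine (hi.ofReal (𝕜 := ℂ)).mul_const (-(2 * Complex.I) * Real.sin (Real.pi * s)) |>.congr ?_
    exact .of_forall fun x => (stripJump_hankelKernel s x).symm
  have hbot : Tendsto (stripJump H) atBot (𝓝 0) := by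
    have h1 : Tendsto (fun ρ : ℝ => Real.exp (Real.exp ρ - s * ρ) * (2 * Real.pi)) atBot
        (𝓝 (0 * (2 * Real.pi))) := by
      refine Tendsto.mul_const _ (Real.tendsto_exp_atBot.comp ?_)
      simp only [sub_eq_add_neg, ← neg_mul]
      exact Real.tendsto_exp_atBot.add_atBot (tendsto_id.const_mul_atBot (neg_pos.2 hs₀))
    rw [zero_mul] at h1
    refine squeeze_zero_norm (fun ρ => norm_stripJump_le (fun u _ => hH u) ?_) h1
    rintro u rfl
    exact norm_hankelKernel_le s u
  have htop := tendsto_limUnder_of_hasDerivAt_of_integrableOn_Ioi (a := 0) (fun x _ => hJ x)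
    hint.integrableOn
  have heq := integral_of_hasDerivAt_of_tendsto hJ hint hbot htop
  simp only [stripJump_hankelKernel] at heq
  rw [integral_mul_const, integral_complex_ofReal, hG, sub_zero] at heq
  rw [← heq] at htop
  convert htop using 2
  have hg := Real.Gamma_mul_Gamma_one_sub (-s)
  have hne : Real.Gamma (s + 1) ≠ 0 := (Real.Gamma_pos_of_pos (by linarith)).ne'
  have hsin : Real.sin (Real.pi * s) ≠ 0 := by
    refine (Real.sin_neg_of_neg_of_neg_pi_lt ?_ ?_).ne <;> nlinarith [Real.pi_pos]
  rw [sub_neg_eq_add, add_comm 1 s, mul_neg, Real.sin_neg, eq_div_iff (neg_ne_zero.2 hsin)] at hg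
  have hgC := congrArg (Complex.ofReal) hg
  push_cast at hgC
  rw [div_eq_iff (by exact_mod_cast hne)]
  push_cast
  linear_combination -2 * Complex.I * hgC

/-- For `s = 0` the factor `sin (πs)` vanishes and the jump is constant. Its value is read off as `ρ
→ -∞`, where the kernel `exp (exp u)` approaches `1`, whose primitive `id` has jump `2πi`. -/
theorem tendsto_stripJump_of_zero {H : ℂ → ℂ} (hH : ∀ u, HasDerivAt H (hankelKernel 0 u) u) :
    Tendsto (stripJump H) atTop (𝓝 (2 * Real.pi * Complex.I)) := by
  have hJ : ∀ x, HasDerivAt (stripJump H) 0 x := fun x => by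
    have := hasDerivAt_stripJump (ρ := x) (hH _) (hH _)
    simpa [stripJump_hankelKernel] using this
  have hconst : ∀ x, stripJump H x = stripJump H 0 := fun x =>
    is_const_of_deriv_eq_zero (fun x => (hJ x).differentiableAt) (fun x => (hJ x).deriv) x 0
  have hlim : Tendsto (fun ρ => stripJump H ρ - 2 * Real.pi * Complex.I) atBot (𝓝 0) := by
    have h1 : Tendsto (fun ρ : ℝ => 2 * Real.exp ρ * (2 * Real.pi)) atBot
        (𝓝 (2 * 0 * (2 * Real.pi))) :=
      (Real.tendsto_exp_atBot.const_mul _).mul_const _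
    rw [mul_zero, zero_mul] at h1
    refine squeeze_zero_norm' ?_ h1
    filter_upwards [eventually_le_atBot 0] with ρ hρ
    have := norm_stripJump_le (ρ := ρ) (C := 2 * Real.exp ρ)
      (fun u _ => (hH u).sub (hasDerivAt_id u)) (fun u hu => by
        have h2 : ‖Complex.exp u‖ = Real.exp ρ := by rw [Complex.norm_exp, hu]
        have h3 := Complex.norm_exp_sub_one_le (x := Complex.exp u)
          (by rw [h2]; exact Real.exp_le_one_iff.2 hρ)
        simpa [hankelKernel, h2] using h3)
    have heq : stripJump (H - id) ρ = stripJump H ρ - 2 * Real.pi * Complex.I := by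
      simp only [stripJump, Pi.sub_apply, id]
      ring
    rwa [heq] at this
  have h2 : stripJump H 0 - 2 * Real.pi * Complex.I = 0 :=
    tendsto_nhds_unique tendsto_const_nhds (hlim.congr fun x => by rw [hconst x])
  rw [← sub_eq_zero.1 h2]
  exact tendsto_const_nhds.congr fun x => (hconst x).symm

/-- Hankel's integral formula for the reciprocal Gamma function, in logarithmic coordinates. -/
theorem tendsto_stripJump_hankel {s : ℝ} (hs : -1 < s) {H : ℂ → ℂ}
    (hH : ∀ u, HasDerivAt H (hankelKernel s u) u) :
    Tendsto (stripJump H) atTop (𝓝 (2 * Real.pi * Complex.I / Real.Gamma (s + 1))) := by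
  -- Induction on an integer bound for `s` reduces to `-1 < s ≤ 0` by integration by parts.
  obtain ⟨n, hn⟩ := exists_nat_ge s
  induction n generalizing s H with
  | zero =>
    rcases hn.lt_or_eq with h | h
    · exact tendsto_stripJump_of_neg hs (by simpa using h) hH
    · obtain rfl : s = 0 := by simpa using h
      simpa using tendsto_stripJump_of_zero hH
  | succ n ih =>
    rcases le_or_gt s 0 with h0 | h0
    · exact ih hs hH (h0.trans n.cast_nonneg)
    obtain ⟨t, rfl⟩ : ∃ t, s = t + 1 := ⟨s - 1, by ring⟩
    -- The kernel of index `t + 1` has derivative (kernel of index `t`) `- (t + 1)` (kernel of index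
    -- `t + 1`); the boundary terms vanish at infinity on both edges.
    have hd : ∀ u, HasDerivAt (fun u => hankelKernel (t + 1) u + (t + 1 : ℝ) * H u)
        (hankelKernel t u) u := fun u => by
      refine ((hasDerivAt_hankelKernel (t + 1) u).add ((hH u).const_mul _)).congr_deriv ?_
      rw [hankelKernel_eq_exp_mul t]
      ring
    have h1 := ih (by linarith) hd (by push_cast at hn; linarith)
    have h2 := tendsto_hankelKernel_zero h0.le Real.cos_pi
    have h3 := tendsto_hankelKernel_zero h0.le (c := -Real.pi) (by simp)
    have h4 := ((h1.sub h2).add h3).const_mul (((t + 1 : ℝ) : ℂ)⁻¹)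
    have ht : ((t + 1 : ℝ) : ℂ) ≠ 0 := by exact_mod_cast h0.ne'
    convert h4 using 2
    · simp only [stripJump, Complex.ofReal_neg, neg_mul, ← sub_eq_add_neg]
      field_simp
      ring
    · rw [Real.Gamma_add_one h0.ne']
      push_cast at ht ⊢
      rw [sub_zero, add_zero, mul_comm ((t : ℂ) + 1), ← div_div, inv_mul_eq_div]

/-! ### The density on a half-plane and its series expansion -/

/-- The function `ω ^ α e ^ ω / (ω ^ α - ξ)` in the logarithmic coordinate `u = log ω`. -/
def hankelDensity (α : ℝ) (ξ u : ℂ) : ℂ :=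
  Complex.exp (Complex.exp u) * (1 - ξ * Complex.exp (-α * u))⁻¹

/-- The half-plane on which `|ξ| < |e ^ (α u)|`. -/
def hankelDomain (α : ℝ) (ξ : ℂ) : Set ℂ := {u | ‖ξ‖ < Real.exp (α * u.re)}

theorem norm_mul_exp_neg (α : ℝ) (ξ u : ℂ) :
    ‖ξ * Complex.exp (-α * u)‖ = ‖ξ‖ * Real.exp (-α * u.re) := by
  simp [Complex.norm_exp]

theorem mul_exp_neg_lt_one {a x : ℝ} (h : a < Real.exp x) : a * Real.exp (-x) < 1 := by
  rw [Real.exp_neg, ← div_eq_mul_inv]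
  exact (div_lt_one (Real.exp_pos _)).2 h

theorem norm_mul_exp_neg_lt_one {α : ℝ} {ξ u : ℂ} (hu : u ∈ hankelDomain α ξ) :
    ‖ξ * Complex.exp (-α * u)‖ < 1 := by
  rw [norm_mul_exp_neg, neg_mul]
  exact mul_exp_neg_lt_one hu

theorem one_sub_ne_zero_of_norm_lt_one {w : ℂ} (hw : ‖w‖ < 1) : 1 - w ≠ 0 := by
  rintro h
  rw [← sub_eq_zero.1 h] at hw
  simp at hw

theorem isOpen_hankelDomain (α : ℝ) (ξ : ℂ) : IsOpen (hankelDomain α ξ) :=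
  isOpen_lt continuous_const (by fun_prop)

theorem convex_hankelDomain {α : ℝ} (ξ : ℂ) : Convex ℝ (hankelDomain α ξ) := by
  intro x hx y hy a b ha hb hab
  have h : min (α * x.re) (α * y.re) ≤ α * (a • x + b • y).re := by
    simp only [Complex.add_re, Complex.real_smul, Complex.mul_re, Complex.ofReal_re,
      Complex.ofReal_im, zero_mul, sub_zero]
    have h1 := mul_le_mul_of_nonneg_left (min_le_left (α * x.re) (α * y.re)) ha
    have h2 := mul_le_mul_of_nonneg_left (min_le_right (α * x.re) (α * y.re)) hb
    obtain rfl : b = 1 - a := by linarith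
    nlinarith
  have h3 : ‖ξ‖ < Real.exp (min (α * x.re) (α * y.re)) := by
    rcases min_choice (α * x.re) (α * y.re) with h | h <;> rw [h]
    exacts [hx, hy]
  exact h3.trans_le (Real.exp_le_exp.2 h)

theorem exists_primitive_hankelDensity (α : ℝ) (ξ : ℂ) :
    ∃ G : ℂ → ℂ, ∀ u ∈ hankelDomain α ξ, HasDerivAt G (hankelDensity α ξ u) u := by
  have hd : DifferentiableOn ℂ (hankelDensity α ξ) (hankelDomain α ξ) := by
    intro u hu
    have := one_sub_ne_zero_of_norm_lt_one (norm_mul_exp_neg_lt_one hu)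
    refine DifferentiableAt.differentiableWithinAt ?_
    refine DifferentiableAt.mul (by fun_prop) (DifferentiableAt.inv (by fun_prop) this)
  obtain ⟨G, hG⟩ := (convex_hankelDomain ξ).exists_forall_hasDerivWithinAt hd
  exact ⟨G, fun u hu => (hG u hu).hasDerivAt ((isOpen_hankelDomain α ξ).mem_nhds hu)⟩

theorem mem_hankelDomain_of_le {α : ℝ} (hα : 0 < α) {ξ : ℂ} {ρ : ℝ} (hρ : ‖ξ‖ < Real.exp (α * ρ))
    {u : ℂ} (hu : ρ ≤ u.re) : u ∈ hankelDomain α ξ :=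
  hρ.trans_le (by gcongr)

theorem norm_hankelDensity_le {α : ℝ} (hα : 0 < α) {ξ : ℂ} {ρ : ℝ}
    (hρ : ‖ξ‖ < Real.exp (α * ρ)) {u : ℂ} (hu : ρ ≤ u.re) :
    ‖hankelDensity α ξ u‖ ≤
      Real.exp (Real.exp u.re * Real.cos u.im) * (1 - ‖ξ‖ * Real.exp (-(α * ρ)))⁻¹ := by
  have h1 : ‖ξ * Complex.exp (-α * u)‖ ≤ ‖ξ‖ * Real.exp (-(α * ρ)) := by
    rw [norm_mul_exp_neg, neg_mul]
    gcongr
  have h2 := mul_exp_neg_lt_one hρ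
  have h3 : 1 - ‖ξ‖ * Real.exp (-(α * ρ)) ≤ ‖1 - ξ * Complex.exp (-α * u)‖ := by
    have := norm_sub_norm_le 1 (ξ * Complex.exp (-α * u))
    rw [norm_one] at this
    linarith
  rw [hankelDensity, norm_mul, norm_inv, Complex.norm_exp, Complex.exp_re]
  gcongr

theorem exists_norm_lt_exp {α : ℝ} (hα : 0 < α) (ξ : ℂ) : ∃ ρ : ℝ, ‖ξ‖ < Real.exp (α * ρ) := by
  refine ⟨‖ξ‖ / α, ?_⟩
  rw [mul_div_cancel₀ _ hα.ne']
  linarith [Real.add_one_le_exp ‖ξ‖]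

theorem hasSum_hankelDensity {α : ℝ} {ξ u : ℂ} (hu : u ∈ hankelDomain α ξ) :
    HasSum (fun k : ℕ => ξ ^ k * hankelKernel (α * k) u) (hankelDensity α ξ u) := by
  refine ((hasSum_geometric_of_norm_lt_one (norm_mul_exp_neg_lt_one hu)).mul_left _).congr_fun ?_
  intro k
  rw [hankelKernel, sub_eq_add_neg, Complex.exp_add, mul_pow, ← Complex.exp_nat_mul]
  push_cast
  ring_nf

theorem stripJump_eq_integral {H h : ℂ → ℂ} {ρ : ℝ} (hH : ∀ u : ℂ, u.re = ρ → HasDerivAt H (h u) u)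
    (hc : Continuous fun θ : ℝ => h (ρ + θ * Complex.I)) :
    stripJump H ρ = ∫ θ in (-Real.pi)..Real.pi, h (ρ + θ * Complex.I) * Complex.I := by
  rw [intervalIntegral.integral_eq_sub_of_hasDerivAt (f := fun θ : ℝ => H (ρ + θ * Complex.I))
    (f' := fun θ : ℝ => h (ρ + θ * Complex.I) * Complex.I)
    (fun θ _ => ?_) ((hc.mul continuous_const).intervalIntegrable _ _)]
  · simp [stripJump, sub_eq_add_neg]
  · have h1 : HasDerivAt (fun x : ℂ => (ρ : ℂ) + x * Complex.I) Complex.I (θ : ℂ) := by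
      simpa using ((hasDerivAt_id (θ : ℂ)).mul_const Complex.I).const_add (ρ : ℂ)
    exact ((hH _ (by simp)).comp (θ : ℂ) h1).comp_ofReal

/-- On the compact segment `Re u = ρ` the expansion is dominated by a geometric series, so it may be
integrated term by term. -/
theorem hasSum_stripJump {α : ℝ} {ξ : ℂ} {G : ℂ → ℂ}
    (hG : ∀ u ∈ hankelDomain α ξ, HasDerivAt G (hankelDensity α ξ u) u) {H : ℕ → ℂ → ℂ}
    (hH : ∀ (k : ℕ) (u : ℂ), HasDerivAt (H k) (hankelKernel (α * k) u) u) {ρ : ℝ}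
    (hρ : ‖ξ‖ < Real.exp (α * ρ)) :
    HasSum (fun k => ξ ^ k * stripJump (H k) ρ) (stripJump G ρ) := by
  have hmem : ∀ u : ℂ, u.re = ρ → u ∈ hankelDomain α ξ := by rintro u rfl; exact hρ
  have hcont : Continuous fun θ : ℝ => hankelDensity α ξ (ρ + θ * Complex.I) := by
    refine Continuous.mul (by fun_prop) (Continuous.inv₀ (by fun_prop) fun θ => ?_)
    exact one_sub_ne_zero_of_norm_lt_one (norm_mul_exp_neg_lt_one (hmem _ (by simp)))
  have hk : ∀ k : ℕ, Continuous fun θ : ℝ =>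
      ξ ^ k * (hankelKernel (α * k) (ρ + θ * Complex.I) * Complex.I) := fun k => by
    unfold hankelKernel; fun_prop
  rw [stripJump_eq_integral (fun u hu => hG u (hmem u hu)) hcont]
  have hJ : ∀ k : ℕ, ξ ^ k * stripJump (H k) ρ = ∫ θ in (-Real.pi)..Real.pi,
      ξ ^ k * (hankelKernel (α * k) (ρ + θ * Complex.I) * Complex.I) := fun k => by
    rw [intervalIntegral.integral_const_mul, stripJump_eq_integral (fun u _ => hH k u)
      ((continuous_hankelKernel _).comp (by fun_prop))]
  simp only [hJ]
  have hq0 : 0 ≤ ‖ξ‖ * Real.exp (-(α * ρ)) := by positivity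
  refine intervalIntegral.hasSum_integral_of_dominated_convergence
    (fun k _ => Real.exp (Real.exp ρ) * (‖ξ‖ * Real.exp (-(α * ρ))) ^ k)
    (fun k => (hk k).aestronglyMeasurable)
    (fun k => .of_forall fun θ _ => ?_)
    (.of_forall fun θ _ => (summable_geometric_of_lt_one hq0 (mul_exp_neg_lt_one hρ)).mul_left _)
    (by simp) (.of_forall fun θ _ => ?_)
  · have := norm_hankelKernel_le (α * k) (ρ + θ * Complex.I)
    simp only [Complex.add_re, Complex.ofReal_re, Complex.mul_re, Complex.I_re, mul_zero,
      Complex.ofReal_im, Complex.I_im, mul_one, sub_self, add_zero] at this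
    rw [norm_mul, norm_pow, norm_mul, Complex.norm_I, mul_one, mul_pow, ← Real.exp_nat_mul,
      mul_left_comm, ← Real.exp_add]
    gcongr
    refine this.trans (le_of_eq ?_)
    ring_nf
  · simpa only [mul_assoc] using
      (hasSum_hankelDensity (hmem (ρ + θ * Complex.I) (by simp))).mul_right Complex.I

/-- The series of the Mittag-Leffler function converges, and its sum is given by the limit of the
jumps of a primitive of the density. -/
theorem summable_and_tendsto_stripJump_hankelDensity {α : ℝ} (hα : 0 < α) (ξ : ℂ) {G : ℂ → ℂ}
    (hG : ∀ u ∈ hankelDomain α ξ, HasDerivAt G (hankelDensity α ξ u) u) :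
    Summable (fun k : ℕ => ξ ^ k * (Complex.Gamma (α * k + 1))⁻¹) ∧
      Tendsto (stripJump G) atTop (𝓝 (2 * Real.pi * Complex.I *
        ∑' k : ℕ, ξ ^ k * (Complex.Gamma (α * k + 1))⁻¹)) := by
  choose H hH using fun k : ℕ => exists_primitive_hankelKernel (α * k)
  obtain ⟨ρ₀, hρ₀⟩ := exists_norm_lt_exp hα ξ
  have hk0 : ∀ k : ℕ, 0 ≤ α * k := fun k => by positivity
  have hlim : ∀ k : ℕ, Tendsto (fun ρ => ξ ^ k * stripJump (H k) ρ) atTop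
      (𝓝 (2 * Real.pi * Complex.I * (ξ ^ k * (Complex.Gamma (α * k + 1))⁻¹))) := fun k => by
    convert (tendsto_stripJump_hankel (by linarith [hk0 k]) (hH k)).const_mul (ξ ^ k) using 2
    rw [← Complex.Gamma_ofReal]
    push_cast
    ring
  set C := 2 * Real.pi * Real.exp (Real.exp ρ₀) + 2 * Real.exp (-ρ₀)
  have hbound : ∀ ρ, ρ₀ ≤ ρ → ∀ k : ℕ,
      ‖ξ ^ k * stripJump (H k) ρ‖ ≤ (‖ξ‖ * Real.exp (-(α * ρ₀))) ^ k * C := fun ρ hρ k => by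
    have := norm_stripJump_primitive_le (hk0 k) (hH k) hρ
    rw [norm_mul, norm_pow, mul_pow, mul_assoc, ← Real.exp_nat_mul]
    gcongr
    refine this.trans (le_of_eq ?_)
    rw [mul_neg, neg_mul, mul_left_comm, mul_assoc, mul_left_comm α]
  have hsum : Summable fun k : ℕ => (‖ξ‖ * Real.exp (-(α * ρ₀))) ^ k * C :=
    (summable_geometric_of_lt_one (by positivity) (mul_exp_neg_lt_one hρ₀)).mul_right C
  -- The bound, uniform in `ρ`, passes to the limit, so convergence of the Mittag-Leffler series
  -- needs no separate estimate of Gamma.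
  have hS : Summable fun k : ℕ =>
      2 * Real.pi * Complex.I * (ξ ^ k * (Complex.Gamma (α * k + 1))⁻¹) :=
    .of_norm_bounded hsum fun k => le_of_tendsto (hlim k).norm
      ((eventually_ge_atTop ρ₀).mono fun ρ hρ => hbound ρ hρ k)
  have hpi : (2 * Real.pi * Complex.I : ℂ) ≠ 0 := Complex.two_pi_I_ne_zero
  refine ⟨(summable_mul_left_iff hpi).1 hS, ?_⟩
  rw [← tsum_mul_left]
  refine (tendsto_tsum_of_dominated_convergence hsum hlim
    ((eventually_ge_atTop ρ₀).mono hbound)).congr' ?_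
  filter_upwards [eventually_ge_atTop ρ₀] with ρ hρ
  exact (hasSum_stripJump hG hH (hρ₀.trans_le (by gcongr))).tsum_eq

/-- A primitive of the density has a limit as `Re u → ∞` and `Im u → c`, where `cos c = -1`. -/
theorem exists_tendsto_primitive_hankelDensity {α : ℝ} (hα : 0 < α) {ξ : ℂ} {G : ℂ → ℂ}
    (hG : ∀ u ∈ hankelDomain α ξ, HasDerivAt G (hankelDensity α ξ u) u) {c : ℝ}
    (hc : Real.cos c = -1) :
    ∃ L, ∀ {l : Filter ℝ} {ρ θ : ℝ → ℝ}, Tendsto ρ l atTop → Tendsto θ l (𝓝 c) →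
      Tendsto (fun t => G (ρ t + θ t * Complex.I)) l (𝓝 L) := by
  obtain ⟨ρ₀, hρ₀⟩ := exists_norm_lt_exp hα ξ
  set C := (1 - ‖ξ‖ * Real.exp (-(α * ρ₀)))⁻¹
  have hC : 0 ≤ C := inv_nonneg.2 (by linarith [mul_exp_neg_lt_one hρ₀])
  have hD : ∀ {x : ℝ} (y : ℝ), ρ₀ ≤ x → HasDerivAt G (hankelDensity α ξ (x + y * Complex.I))
      (x + y * Complex.I) := fun {x} y hx =>
    hG _ (mem_hankelDomain_of_le hα hρ₀ (by simpa using hx))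
  have hB : ∀ {x y : ℝ}, ρ₀ ≤ x → ‖hankelDensity α ξ (x + y * Complex.I)‖ ≤
      Real.exp (Real.exp x * Real.cos y) * C := fun {x y} hx => by
    simpa using norm_hankelDensity_le hα hρ₀ (u := x + y * Complex.I) (by simpa using hx)
  have hd : ∀ x ∈ Set.Ioi ρ₀, HasDerivAt (fun x : ℝ => G (x + c * Complex.I))
      (hankelDensity α ξ (x + c * Complex.I)) x := fun x hx => hasDerivAt_horizontal (hD c hx.le)
  have hint : IntegrableOn (fun x : ℝ => hankelDensity α ξ (x + c * Complex.I)) (Set.Ioi ρ₀) := by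
    have h1 : IntegrableOn (fun x : ℝ => Real.exp (-x) * C) (Set.Ioi ρ₀) :=
      (integrableOn_exp_neg_Ioi ρ₀).mul_const C
    refine Integrable.mono' h1 ?_ ?_
    · refine Measurable.aestronglyMeasurable ?_
      unfold hankelDensity
      fun_prop
    · refine (ae_restrict_iff' measurableSet_Ioi).2 (.of_forall fun x hx => (hB hx.le).trans ?_)
      rw [hc]
      gcongr
      linarith [Real.add_one_le_exp x]
  have hL := tendsto_limUnder_of_hasDerivAt_of_integrableOn_Ioi hd hint
  -- The limit is defined along the horizontal ray `Im u = c`, where the density is integrable; any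
  -- other approach is compared with this ray along vertical segments.
  refine ⟨limUnder atTop fun x : ℝ => G (x + c * Complex.I), fun {l ρ θ} hρ hθ => ?_⟩
  have hdiff : Tendsto (fun t => G (ρ t + θ t * Complex.I) - G (ρ t + c * Complex.I)) l (𝓝 0) := by
    have h1 : Tendsto (fun t => C * |θ t - c|) l (𝓝 (C * |c - c|)) :=
      ((hθ.sub_const c).abs).const_mul C
    rw [sub_self, abs_zero, mul_zero] at h1
    refine squeeze_zero_norm' ?_ h1
    -- Within `π / 2` of `c` the cosine is nonpositive, so the density is bounded by `C` and the
    -- vertical increment by `C * |θ t - c|`.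
    filter_upwards [hρ.eventually_ge_atTop ρ₀,
      hθ.eventually (Metric.ball_mem_nhds c Real.pi_div_two_pos)] with t ht htc
    refine norm_vertical_sub_le (fun y _ => hD y ht) fun y hy => (hB ht).trans ?_
    refine mul_le_of_le_one_left hC (Real.exp_le_one_iff.2 ?_)
    refine mul_nonpos_of_nonneg_of_nonpos (Real.exp_pos _).le ?_
    have hsc : Real.sin c = 0 := by nlinarith [Real.sin_sq_add_cos_sq c]
    have h2 : Real.cos y = -Real.cos (y - c) := by rw [Real.cos_sub, hc, hsc]; ring
    rw [h2, neg_nonpos]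
    have h3 : |y - c| ≤ |θ t - c| := by simpa using Set.abs_sub_left_of_mem_uIcc hy
    have h5 := abs_lt.1 (h3.trans_lt htc)
    exact Real.cos_nonneg_of_mem_Icc ⟨h5.1.le, h5.2.le⟩
  simpa using hdiff.add (hL.comp hρ)

/-! ### Regularity of piecewise continuously differentiable curves -/

/-- At a corner the one-sided limits of the derivative give integrability on each side, and the
corner itself is a null set. -/
theorem IsPiecewiseC1.locallyIntegrable_deriv {γ : ℝ → ℂ} (hγ : IsPiecewiseC1 γ) :
    LocallyIntegrable (deriv γ) := by
  obtain ⟨-, S, -, hS₁, hS₂⟩ := hγ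
  intro t
  have hm : ∀ l : Filter ℝ, StronglyMeasurableAtFilter (deriv γ) l volume := fun l =>
    (measurable_deriv γ).aestronglyMeasurable.stronglyMeasurableAtFilter
  by_cases ht : t ∈ S
  · obtain ⟨⟨l₁, h₁⟩, l₂, h₂⟩ := hS₂ t ht
    have h3 : IntegrableAtFilter (deriv γ) (𝓝[≠] t) := by
      rw [← Set.Iio_union_Ioi, nhdsWithin_union, IntegrableAtFilter.sup_iff]
      exact ⟨(volume.finiteAt_nhdsWithin t _).integrableAtFilter_of_tendsto (hm _) h₁,
        (volume.finiteAt_nhdsWithin t _).integrableAtFilter_of_tendsto (hm _) h₂⟩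
    rw [← nhdsNE_sup_pure, IntegrableAtFilter.sup_iff]
    exact ⟨h3, {t}, mem_pure.2 rfl, by simp⟩
  · have hc : ContinuousAt (deriv γ) t := by
      change ContinuousAt (fun x => fderiv ℝ γ x 1) t
      exact ((hS₁ t ht).continuousAt_fderiv one_ne_zero).clm_apply continuousAt_const
    exact (volume.finiteAt_nhds t).integrableAtFilter_of_tendsto (hm _) hc

theorem IsPiecewiseC1.exists_countable_differentiableAt {γ : ℝ → ℂ} (hγ : IsPiecewiseC1 γ) :
    ∃ S : Set ℝ, S.Countable ∧ ∀ t, t ∉ S → DifferentiableAt ℝ γ t := by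
  obtain ⟨-, S, hS, hS₁, -⟩ := hγ
  refine ⟨S, ?_, fun t ht => (hS₁ t ht).differentiableAt one_ne_zero⟩
  have : S = ⋃ n : ℕ, S ∩ Set.Icc (-n : ℝ) n := by
    refine Set.Subset.antisymm (fun t ht => Set.mem_iUnion.2 ?_)
      (Set.iUnion_subset fun n => Set.inter_subset_left)
    obtain ⟨n, hn⟩ := exists_nat_ge |t|
    exact ⟨n, ht, abs_le.1 hn⟩
  rw [this]
  exact Set.countable_iUnion fun n => (hS _ _).countable

/-! ### The scalar formula along a Hankel loop -/

/-- The complex Hankel integrand `ω ^ (α - 1) e ^ ω / (ω ^ α - ξ)`. -/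
def complexHankelIntegrand (α : ℝ) (ξ ω : ℂ) : ℂ :=
  ω ^ ((α : ℂ) - 1) * Complex.exp ω * (ω ^ (α : ℂ) - ξ)⁻¹

namespace IsHankelLoop

variable {α : ℝ} {ξ : ℂ} {γ : ℝ → ℂ}

theorem norm_pos {r : ℝ} (hr : 0 ≤ r) (hγ : IsHankelLoop r γ) (t : ℝ) : 0 < ‖γ t‖ :=
  hr.trans_lt (hγ.outside t)

theorem mem_slitPlane {r : ℝ} (hr : 0 ≤ r) (hγ : IsHankelLoop r γ) (t : ℝ) :
    γ t ∈ Complex.slitPlane :=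
  Complex.mem_slitPlane_iff_arg.2
    ⟨((le_abs_self _).trans_lt (hγ.abs_arg_lt t)).ne, norm_pos_iff.1 (hγ.norm_pos hr t)⟩

theorem log_mem_hankelDomain (hα : 0 < α) (hγ : IsHankelLoop (‖ξ‖ ^ (1 / α)) γ) (t : ℝ) :
    Complex.log (γ t) ∈ hankelDomain α ξ := by
  have h0 := hγ.norm_pos (by positivity) t
  have h1 := Real.rpow_lt_rpow (by positivity) (hγ.outside t) hα
  rw [← Real.rpow_mul (norm_nonneg ξ), one_div_mul_cancel hα.ne', Real.rpow_one,
    Real.rpow_def_of_pos h0, mul_comm] at h1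
  simpa [hankelDomain, Complex.log_re] using h1

theorem cpow_sub_ne_zero (hα : 0 < α) (hγ : IsHankelLoop (‖ξ‖ ^ (1 / α)) γ) (t : ℝ) :
    γ t ^ (α : ℂ) - ξ ≠ 0 := by
  have h0 := norm_pos_iff.1 (hγ.norm_pos (by positivity) t)
  have h1 := hγ.log_mem_hankelDomain hα t
  intro h
  have h2 : ‖ξ‖ < ‖γ t ^ (α : ℂ)‖ := by
    rw [Complex.cpow_def_of_ne_zero h0, Complex.norm_exp, mul_comm, Complex.re_ofReal_mul]
    exact h1
  rw [sub_eq_zero.1 h] at h2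
  exact lt_irrefl _ h2

/-- This is the change of variable `u = log ω`; the division by `γ t` is the Jacobian `du = dω / ω`.
-/
theorem complexHankelIntegrand_eq (hα : 0 < α) (hγ : IsHankelLoop (‖ξ‖ ^ (1 / α)) γ) (t : ℝ) :
    complexHankelIntegrand α ξ (γ t) = hankelDensity α ξ (Complex.log (γ t)) / γ t := by
  have h0 := norm_pos_iff.1 (hγ.norm_pos (by positivity) t)
  have h1 := hγ.cpow_sub_ne_zero hα t
  have h2 := one_sub_ne_zero_of_norm_lt_one
    (norm_mul_exp_neg_lt_one (hγ.log_mem_hankelDomain hα t))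
  have h3 : γ t ^ (α : ℂ) ≠ 0 := by simp [Complex.cpow_eq_zero_iff, h0]
  have h4 : Complex.exp (-α * Complex.log (γ t)) = (γ t ^ (α : ℂ))⁻¹ := by
    rw [Complex.cpow_def_of_ne_zero h0, ← Complex.exp_neg, neg_mul, mul_comm]
  rw [h4] at h2
  rw [complexHankelIntegrand, hankelDensity, h4, Complex.cpow_sub _ _ h0, Complex.cpow_one,
    Complex.exp_log h0]
  have h5 : (1 - ξ * (γ t ^ (α : ℂ))⁻¹) = (γ t ^ (α : ℂ) - ξ) / γ t ^ (α : ℂ) := by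
    field_simp
  rw [h5, inv_div]
  field_simp

theorem continuous_complexHankelIntegrand (hα : 0 < α) (hγ : IsHankelLoop (‖ξ‖ ^ (1 / α)) γ) :
    Continuous fun t => complexHankelIntegrand α ξ (γ t) := by
  have hc := hγ.piecewiseC1.1
  have hs := hγ.mem_slitPlane (by positivity)
  have hp : ∀ a : ℂ, Continuous fun t => γ t ^ a := fun a =>
    continuous_iff_continuousAt.2 fun t => (hc.continuousAt (x := t)).cpow continuousAt_const (hs t)
  exact ((hp _).mul (by fun_prop)).mul (((hp _).sub continuous_const).inv₀ (hγ.cpow_sub_ne_zero hα))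

theorem intervalIntegrable_integrand (hα : 0 < α) (hγ : IsHankelLoop (‖ξ‖ ^ (1 / α)) γ) (a b : ℝ) :
    IntervalIntegrable (fun t => complexHankelIntegrand α ξ (γ t) * deriv γ t) volume a b :=
  (hγ.piecewiseC1.locallyIntegrable_deriv.integrableOn_isCompact
    isCompact_uIcc).intervalIntegrable.continuousOn_mul
    (hγ.continuous_complexHankelIntegrand hα).continuousOn

/-- The scalar Hankel formula for the Mittag-Leffler function. -/
theorem summable_and_tendsto (hα : 0 < α) (hγ : IsHankelLoop (‖ξ‖ ^ (1 / α)) γ) :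
    Summable (fun k : ℕ => ξ ^ k * (Complex.Gamma (α * k + 1))⁻¹) ∧
      Tendsto (fun p : ℝ × ℝ => ∫ t in p.1..p.2, complexHankelIntegrand α ξ (γ t) * deriv γ t)
        (atBot ×ˢ atTop) (𝓝 (2 * Real.pi * Complex.I *
          ∑' k : ℕ, ξ ^ k * (Complex.Gamma (α * k + 1))⁻¹)) := by
  obtain ⟨G, hG⟩ := exists_primitive_hankelDensity α ξ
  obtain ⟨hsum, hlim⟩ := summable_and_tendsto_stripJump_hankelDensity hα ξ hG
  refine ⟨hsum, ?_⟩
  obtain ⟨S, hS, hd⟩ := hγ.piecewiseC1.exists_countable_differentiableAt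
  have hs := hγ.mem_slitPlane (by positivity)
  have hftc : ∀ a b : ℝ, ∫ t in a..b, complexHankelIntegrand α ξ (γ t) * deriv γ t =
      G (Complex.log (γ b)) - G (Complex.log (γ a)) := fun a b => by
    refine integral_eq_of_hasDerivAt_off_countable (fun t => G (Complex.log (γ t))) _ hS
      (Continuous.continuousOn ?_) (fun t ht => ?_) (hγ.intervalIntegrable_integrand hα a b)
    · exact continuous_iff_continuousAt.2 fun t =>
        (hG _ (hγ.log_mem_hankelDomain hα t)).continuousAt.comp
          (f := fun t => Complex.log (γ t)) (hγ.piecewiseC1.1.continuousAt.clog (hs t))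
    · have h1 := (hG _ (hγ.log_mem_hankelDomain hα t)).comp t
        ((hd t ht.2).hasDerivAt.clog_real (hs t))
      refine h1.congr_deriv ?_
      rw [hγ.complexHankelIntegrand_eq hα]
      ring
  obtain ⟨L₁, h₁⟩ := exists_tendsto_primitive_hankelDensity hα hG Real.cos_pi
  obtain ⟨L₂, h₂⟩ := exists_tendsto_primitive_hankelDensity hα hG (c := -Real.pi) (by simp)
  have hlog : ∀ t, Complex.log (γ t) =
      (Real.log ‖γ t‖ : ℝ) + (Complex.arg (γ t) : ℝ) * Complex.I := fun t => rfl
  have hb : Tendsto (fun t => G (Complex.log (γ t))) atTop (𝓝 L₁) := by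
    simp only [hlog]
    exact h₁ (Real.tendsto_log_atTop.comp hγ.norm_atTop) hγ.arg_atTop
  have ha : Tendsto (fun t => G (Complex.log (γ t))) atBot (𝓝 L₂) := by
    simp only [hlog]
    exact h₂ (Real.tendsto_log_atTop.comp hγ.norm_atBot) hγ.arg_atBot
  -- The same limits `L₁`, `L₂` are attained along the straight edges `Im u = ±π`, where the
  -- difference is `stripJump G`.
  have hL : L₁ - L₂ = 2 * Real.pi * Complex.I *
      ∑' k : ℕ, ξ ^ k * (Complex.Gamma (α * k + 1))⁻¹ := by
    refine tendsto_nhds_unique ?_ hlim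
    have h3 := (h₁ tendsto_id tendsto_const_nhds).sub (h₂ tendsto_id tendsto_const_nhds)
    refine h3.congr fun x => ?_
    simp [stripJump, sub_eq_add_neg]
  simp only [hftc]
  rw [← hL]
  exact (hb.comp tendsto_snd).sub (ha.comp tendsto_fst)

end IsHankelLoop

/-! ### Componentwise calculus in the idempotent basis -/

namespace Bicomplex

theorem ext_P {x y : Bicomplex} (h₁ : P₁ x = P₁ y) (h₂ : P₂ x = P₂ y) : x = y := by
  rw [← ofIdem_P x, ← ofIdem_P y, h₁, h₂]

theorem ofIdem_mk (a b : ℂ) : ofIdem a b = ⟨(a + b) / 2, Complex.I * (a - b) / 2⟩ := by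
  refine ext_P ?_ ?_
  · rw [P₁_ofIdem, P₁]
    linear_combination (a - b) / 2 * Complex.I_mul_I
  · rw [P₂_ofIdem, P₂]
    linear_combination (b - a) / 2 * Complex.I_mul_I

theorem ofIdem_mul (a b c d : ℂ) : ofIdem a b * ofIdem c d = ofIdem (a * c) (b * d) := by
  simp only [ofIdem_mk]
  ext1
  · rw [mul_z₁]
    linear_combination -(a - b) * (c - d) / 4 * Complex.I_mul_I
  · rw [mul_z₂]
    ring

theorem ofIdem_add (a b c d : ℂ) : ofIdem a b + ofIdem c d = ofIdem (a + c) (b + d) := by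
  simp only [ofIdem_mk]
  ext1
  · rw [add_z₁]; ring
  · rw [add_z₂]; ring

theorem ofIdem_sub (a b c d : ℂ) : ofIdem a b - ofIdem c d = ofIdem (a - c) (b - d) := by
  simp only [ofIdem_mk]
  ext1
  · rw [sub_z₁]; ring
  · rw [sub_z₂]; ring

theorem smul_ofIdem (r : ℝ) (a b : ℂ) : r • ofIdem a b = ofIdem (r • a) (r • b) := by
  simp only [ofIdem_mk]
  ext1
  · simp only [smul_z₁, Complex.real_smul]; ring
  · simp only [smul_z₂, Complex.real_smul]; ring

theorem ofComplex_eq_ofIdem (z : ℂ) : (z : Bicomplex) = ofIdem z z := by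
  simp [ofIdem_mk, ofComplex]

theorem one_eq_ofIdem : (1 : Bicomplex) = ofIdem 1 1 := ofComplex_eq_ofIdem 1

theorem natCast_eq_ofIdem (k : ℕ) : (k : Bicomplex) = ofIdem k k := by
  induction k with
  | zero => rw [Nat.cast_zero, Nat.cast_zero, ← ofComplex_eq_ofIdem]; rfl
  | succ k ih => rw [Nat.cast_succ, ih, one_eq_ofIdem, ofIdem_add, Nat.cast_succ]

theorem ofIdem_pow (a b : ℂ) (k : ℕ) : ofIdem a b ^ k = ofIdem (a ^ k) (b ^ k) := by
  induction k with
  | zero => simpa using one_eq_ofIdem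
  | succ k ih => rw [pow_succ, ih, ofIdem_mul, pow_succ, pow_succ]

theorem ofIdem_mul_inv {a b : ℂ} (ha : a ≠ 0) (hb : b ≠ 0) :
    ofIdem a b * ofIdem a⁻¹ b⁻¹ = 1 := by
  rw [ofIdem_mul, mul_inv_cancel₀ ha, mul_inv_cancel₀ hb, one_eq_ofIdem]

theorem isUnit_ofIdem {a b : ℂ} (ha : a ≠ 0) (hb : b ≠ 0) : IsUnit (ofIdem a b) :=
  IsUnit.of_mul_eq_one _ (ofIdem_mul_inv ha hb)

/-- Both components must be nonzero: `Ring.inverse` is `0` at every nonunit, including zero divisors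
with a single vanishing component. -/
theorem inverse_ofIdem {a b : ℂ} (ha : a ≠ 0) (hb : b ≠ 0) :
    Ring.inverse (ofIdem a b) = ofIdem a⁻¹ b⁻¹ := by
  rw [← mul_one (Ring.inverse _), ← ofIdem_mul_inv ha hb,
    Ring.inverse_mul_cancel_left _ _ (isUnit_ofIdem ha hb)]

/-- The linear isomorphism from `ℂ × ℂ` given by the idempotent components. -/
def ofIdemEquiv : (ℂ × ℂ) ≃ₗ[ℝ] Bicomplex where
  toFun p := ofIdem p.1 p.2
  map_add' p q := (ofIdem_add _ _ _ _).symm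
  map_smul' r p := (smul_ofIdem _ _ _).symm
  invFun x := (P₁ x, P₂ x)
  left_inv p := by simp [P₁_ofIdem, P₂_ofIdem]
  right_inv x := ofIdem_P x

instance : FiniteDimensional ℝ Bicomplex := ofIdemEquiv.finiteDimensional

instance : CompleteSpace Bicomplex := FiniteDimensional.complete ℝ Bicomplex

/-- `Bicomplex.ofIdem` as a continuous linear map. -/
def ofIdemL : (ℂ × ℂ) →L[ℝ] Bicomplex := LinearMap.toContinuousLinearMap ofIdemEquiv.toLinearMap

theorem ofIdemL_apply (p : ℂ × ℂ) : ofIdemL p = ofIdem p.1 p.2 := rfl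

theorem mittagLefflerTerm_eq {α : ℝ} (hα : 0 < α) (ξ : Bicomplex) (k : ℕ) :
    mittagLefflerTerm ((α : ℂ) : Bicomplex) ξ k = ofIdemL
      (P₁ ξ ^ k * (Complex.Gamma (α * k + 1))⁻¹, P₂ ξ ^ k * (Complex.Gamma (α * k + 1))⁻¹) := by
  have hΓ : Complex.Gamma (α * k + 1) ≠ 0 := by
    refine Complex.Gamma_ne_zero_of_re_pos ?_
    have : (0 : ℝ) ≤ α * k := by positivity
    simp only [Complex.add_re, Complex.re_ofReal_mul, Complex.natCast_re, Complex.one_re]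
    linarith
  conv_lhs => rw [← ofIdem_P ξ]
  rw [mittagLefflerTerm, natCast_eq_ofIdem, ofComplex_eq_ofIdem, one_eq_ofIdem, ofIdem_mul,
    ofIdem_add, Gamma, P₁_ofIdem, P₂_ofIdem, inverse_ofIdem hΓ hΓ, ofIdem_pow, ofIdem_mul,
    ofIdemL_apply]

theorem cpow_sub_eq (α : ℝ) (ξ : Bicomplex) (a b : ℂ) :
    cpow (ofIdem a b) ((α : ℂ) : Bicomplex) - ξ =
      ofIdem (a ^ (α : ℂ) - P₁ ξ) (b ^ (α : ℂ) - P₂ ξ) := by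
  conv_lhs => rw [← ofIdem_P ξ]
  rw [cpow, ofComplex_eq_ofIdem]
  simp only [P₁_ofIdem, P₂_ofIdem, ofIdem_sub]

theorem hankelIntegrand_eq {α : ℝ} {ξ : Bicomplex} {a b : ℂ} (ha : a ^ (α : ℂ) - P₁ ξ ≠ 0)
    (hb : b ^ (α : ℂ) - P₂ ξ ≠ 0) :
    hankelIntegrand ((α : ℂ) : Bicomplex) ξ (ofIdem a b) =
      ofIdem (complexHankelIntegrand α (P₁ ξ) a) (complexHankelIntegrand α (P₂ ξ) b) := by
  rw [hankelIntegrand, cpow_sub_eq, inverse_ofIdem ha hb, cpow, exp, ofComplex_eq_ofIdem,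
    one_eq_ofIdem, ofIdem_sub]
  simp only [P₁_ofIdem, P₂_ofIdem, ofIdem_mul, complexHankelIntegrand]

theorem deriv_pairCurve {Ω₁ Ω₂ : ℝ → ℂ} {t : ℝ} (h₁ : DifferentiableAt ℝ Ω₁ t)
    (h₂ : DifferentiableAt ℝ Ω₂ t) :
    deriv (pairCurve Ω₁ Ω₂) t = ofIdem (deriv Ω₁ t) (deriv Ω₂ t) :=
  (ofIdemL.hasFDerivAt.comp_hasDerivAt t (h₁.hasDerivAt.prodMk h₂.hasDerivAt)).deriv

end Bicomplex

/-! ### Recombination of the two components -/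

open Bicomplex in
theorem mainTheorem5 (α : ℝ) (hα : 0 < α) (ξ : Bicomplex) (Ω₁ Ω₂ : ℝ → ℂ)
    (hΩ₁ : IsHankelLoop (‖Bicomplex.P₁ ξ‖ ^ (1 / α)) Ω₁)
    (hΩ₂ : IsHankelLoop (‖Bicomplex.P₂ ξ‖ ^ (1 / α)) Ω₂) :
    Summable (Bicomplex.mittagLefflerTerm ((α : ℂ) : Bicomplex) ξ) ∧
      (∀ t, IsUnit
        (Bicomplex.cpow (Bicomplex.pairCurve Ω₁ Ω₂ t) ((α : ℂ) : Bicomplex) - ξ)) ∧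
      Bicomplex.CurveIntegrable (Bicomplex.hankelIntegrand ((α : ℂ) : Bicomplex) ξ)
        (Bicomplex.pairCurve Ω₁ Ω₂) ∧
      Bicomplex.mittagLeffler ((α : ℂ) : Bicomplex) ξ =
        ((1 / (2 * (Real.pi : ℂ) * Complex.I) : ℂ) : Bicomplex) *
          Bicomplex.curveIntegral (Bicomplex.hankelIntegrand ((α : ℂ) : Bicomplex) ξ)
            (Bicomplex.pairCurve Ω₁ Ω₂) := by
  obtain ⟨hs₁, hl₁⟩ := hΩ₁.summable_and_tendsto hα
  obtain ⟨hs₂, hl₂⟩ := hΩ₂.summable_and_tendsto hα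
  have hsum := ofIdemL.hasSum (hs₁.hasSum.prodMk hs₂.hasSum)
  have hsum' : HasSum (mittagLefflerTerm ((α : ℂ) : Bicomplex) ξ) _ :=
    hsum.congr_fun fun k => mittagLefflerTerm_eq hα ξ k
  obtain ⟨S₁, hS₁, hd₁⟩ := hΩ₁.piecewiseC1.exists_countable_differentiableAt
  obtain ⟨S₂, hS₂, hd₂⟩ := hΩ₂.piecewiseC1.exists_countable_differentiableAt
  have hint : ∀ a b, IntervalIntegrable (fun t =>
      (complexHankelIntegrand α (P₁ ξ) (Ω₁ t) * deriv Ω₁ t,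
        complexHankelIntegrand α (P₂ ξ) (Ω₂ t) * deriv Ω₂ t)) volume a b := fun a b =>
    ⟨(hΩ₁.intervalIntegrable_integrand hα a b).1.prodMk (hΩ₂.intervalIntegrable_integrand hα a b).1,
      (hΩ₁.intervalIntegrable_integrand hα a b).2.prodMk (hΩ₂.intervalIntegrable_integrand hα a b).2⟩
  -- The derivative of the pair curve is split only where both components are differentiable, hence
  -- off a countable set; equality almost everywhere suffices for the integrals.
  have hae : (fun t => ofIdemL (complexHankelIntegrand α (P₁ ξ) (Ω₁ t) * deriv Ω₁ t,
        complexHankelIntegrand α (P₂ ξ) (Ω₂ t) * deriv Ω₂ t)) =ᵐ[volume] fun t =>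
      hankelIntegrand ((α : ℂ) : Bicomplex) ξ (pairCurve Ω₁ Ω₂ t) * deriv (pairCurve Ω₁ Ω₂) t := by
    filter_upwards [(hS₁.union hS₂).ae_notMem volume] with t ht
    rw [deriv_pairCurve (hd₁ t fun h => ht (.inl h)) (hd₂ t fun h => ht (.inr h)), pairCurve,
      hankelIntegrand_eq (hΩ₁.cpow_sub_ne_zero hα t) (hΩ₂.cpow_sub_ne_zero hα t), ofIdem_mul,
      ofIdemL_apply]
  have htrunc : ∀ a b, truncIntegral (hankelIntegrand ((α : ℂ) : Bicomplex) ξ)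
      (pairCurve Ω₁ Ω₂) a b = ofIdemL
        (∫ t in a..b, complexHankelIntegrand α (P₁ ξ) (Ω₁ t) * deriv Ω₁ t,
          ∫ t in a..b, complexHankelIntegrand α (P₂ ξ) (Ω₂ t) * deriv Ω₂ t) := fun a b => by
    rw [truncIntegral, ← intervalIntegral.integral_congr_ae_restrict (ae_restrict_of_ae hae),
      ofIdemL.intervalIntegral_comp_comm (hint a b)]
    congr 1
    exact Prod.ext ((ContinuousLinearMap.fst ℝ ℂ ℂ).intervalIntegral_comp_comm (hint a b)).symm
      ((ContinuousLinearMap.snd ℝ ℂ ℂ).intervalIntegral_comp_comm (hint a b)).symm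
  have hlim := (ofIdemL.continuous.tendsto _).comp (hl₁.prodMk_nhds hl₂)
  replace hlim : Tendsto (fun p : ℝ × ℝ => truncIntegral
      (hankelIntegrand ((α : ℂ) : Bicomplex) ξ) (pairCurve Ω₁ Ω₂) p.1 p.2)
      (atBot ×ˢ atTop) _ := hlim.congr fun p => (htrunc p.1 p.2).symm
  refine ⟨hsum'.summable, fun t => ?_, ⟨fun a b => ?_, _, hlim⟩, ?_⟩
  · rw [pairCurve, cpow_sub_eq]
    exact isUnit_ofIdem (hΩ₁.cpow_sub_ne_zero hα t) (hΩ₂.cpow_sub_ne_zero hα t)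
  · have h1 : IntervalIntegrable (fun t => ofIdemL
        (complexHankelIntegrand α (P₁ ξ) (Ω₁ t) * deriv Ω₁ t,
          complexHankelIntegrand α (P₂ ξ) (Ω₂ t) * deriv Ω₂ t)) volume a b :=
      ⟨ofIdemL.integrable_comp (hint a b).1, ofIdemL.integrable_comp (hint a b).2⟩
    exact h1.congr_ae (ae_restrict_of_ae hae)
  · rw [mittagLeffler, hsum'.tsum_eq, Bicomplex.curveIntegral, hlim.limUnder_eq, ofIdemL_apply,
      ofIdemL_apply, ofComplex_eq_ofIdem, ofIdem_mul, one_div,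
      inv_mul_cancel_left₀ Complex.two_pi_I_ne_zero, inv_mul_cancel_left₀ Complex.two_pi_I_ne_zero]

end
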